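/- Let $p$ be a prime. For an unoriented diagram $D$ of a link $L\subset S^3$, the associated core group $\Pi_L^{(2)}$ is the group with one generator for each arc of $D$ and one relator $yx^{-1}yz^{-1}$ for each crossing, where $y$ is the overpass and $x,z$ are the two underpasses at the crossing. The unreduced $p$-th Burnside group $\widehat B_L(p)$ is the group obtained from this presentation by adding all $p$-th powers of words as relators, and $\widehat B^2_L(p)=\widehat B_L(p)/\gamma_2\widehat B_L(p)$ is its quotient by the commutator subgroup $\gamma_2$. A $p$-move replaces two parallel strands of a link by $p$ half twists (a row of $p$ crossings), and two links are $p$-move equivalent if they are related by a finite sequence of $p$-moves and inverses of $p$-moves (up to isotopy). The Magnus $\mathbb Z_p$-expansion $E^p$ is the homomorphism from the free group on $x_1,\dots,x_m$ into the ring of formal power series in non-commuting variables $X_1,\dots,X_m$ over $\mathbb Z_p=\mathbb Z/p\mathbb Z$ (to its group of units) with $E^p(x_i)=1+X_i$ and $E^p(x_i^{-1})=1-X_i+X_i^2-X_i^3+\cdots$. **Theorem.** Let $L$ be a link with $\Pi_L^{(2)}\cong\langle x_1,\dots,x_m\mid R\rangle$ and $\widehat B^2_L(p)\cong\mathbb Z_p^m$.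 If $L$ is $p$-move equivalent to a trivial link, then for every $r\in R$ $$E^p(r)=1+\sum_{(i_1,\dots,i_p)\in\{1,\dots,m\}^p}c(i_1,\dots,i_p)\,X_{i_1}\cdots X_{i_p}+d(p+1)$$ for some $c(i_1,\dots,i_p)\in\mathbb Z_p$ such that $c(i_1,\dots,i_p)=c(i_{\sigma(1)},\dots,i_{\sigma(p)})$ for every permutation $\sigma$ of $\{1,\dots,p\}$, where $d(p+1)$ denotes a series all of whose terms have degree at least $p+1$. In particular, all terms of degree $1$ to $p-1$ of $E^p(r)$ vanish. -/

import Mathlib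

/-! ### Link diagrams

Unoriented link diagrams in the plane are recorded in general position with respect to a height
function.  Read from bottom to top, such a diagram is a finite sequence of horizontal slices, each
containing exactly one local minimum, local maximum or crossing, all other strands in the slice
being vertical. -/

/-- The local pictures of a slice: a local minimum `∪`, a local maximum `∩`, and the two crossings.
Both crossings exchange two adjacent strands; for `cross true` the strand running (upwards) from
left to right is the over-strand, for `cross false` the strand running from right to left is. -/
inductive Piece where
  | cup : Piece
  | cap : Piece
  | cross : Bool → Piece

/-- Number of end points on the lower boundary of a piece. -/
def Piece.bottom : Piece → ℕ
  | .cup => 0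
  | .cap => 2
  | .cross _ => 2

/-- Number of end points on the upper boundary of a piece. -/
def Piece.top : Piece → ℕ
  | .cup => 2
  | .cap => 0
  | .cross _ => 2

/-- A slice: a piece with `left` vertical strands to the left of it (the remaining strands of the
diagram pass vertically to the right of it). -/
structure Slice where
  piece : Piece
  left : ℕ

/-- Number of strands above the slice `s` if there are `n` strands below it. -/
def Slice.next (n : ℕ) (s : Slice) : ℕ := n - s.piece.bottom + s.piece.top

/-- The slices of `w` can be stacked, from bottom to top, on a level with `n` strands, and no
strand is left at the end. -/
def Fits : ℕ → List Slice → Prop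
  | n, [] => n = 0
  | n, s :: w => s.left + s.piece.bottom ≤ n ∧ Fits (s.next n) w

/-- A diagram of a link: a stack of slices with no strands at its bottom and at its top. -/
structure LinkDiagram where
  slices : List Slice
  fits : Fits 0 slices

namespace LinkDiagram

/-- The number of strands on level `k`, that is, just above the first `k` slices. -/
def width (D : LinkDiagram) (k : ℕ) : ℕ := (D.slices.take k).foldl Slice.next 0

/-- The points of the diagram on the levels between the slices: `(k, j)` is the `j`-th point from
the left (counting from `0`) on level `k`. -/
def Point (D : LinkDiagram) : Type :=
  {q : ℕ × ℕ // q.1 ≤ D.slices.length ∧ q.2 < D.width q.1}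

/-- Two points are directly joined inside one slice by a piece of the diagram that is not an
under-strand of a crossing. -/
inductive Joined (D : LinkDiagram) : D.Point → D.Point → Prop
  /-- vertical strands on the left of the piece -/
  | left (a b : D.Point) (k j : ℕ) (s : Slice) (hs : D.slices[k]? = some s) (hj : j < s.left)
      (ha : a.1 = (k, j)) (hb : b.1 = (k + 1, j)) : Joined D a b
  /-- vertical strands on the right of the piece -/
  | right (a b : D.Point) (k j : ℕ) (s : Slice) (hs : D.slices[k]? = some s)
      (ha : a.1 = (k, s.left + s.piece.bottom + j))
      (hb : b.1 = (k + 1, s.left + s.piece.top + j)) : Joined D a b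
  /-- the two ends of a local minimum -/
  | cup (a b : D.Point) (k i : ℕ) (hs : D.slices[k]? = some ⟨.cup, i⟩)
      (ha : a.1 = (k + 1, i)) (hb : b.1 = (k + 1, i + 1)) : Joined D a b
  /-- the two ends of a local maximum -/
  | cap (a b : D.Point) (k i : ℕ) (hs : D.slices[k]? = some ⟨.cap, i⟩)
      (ha : a.1 = (k, i)) (hb : b.1 = (k, i + 1)) : Joined D a b
  /-- the over-strand of a crossing, running from left to right -/
  | overRight (a b : D.Point) (k i : ℕ) (hs : D.slices[k]? = some ⟨.cross true, i⟩)
      (ha : a.1 = (k, i)) (hb : b.1 = (k + 1, i + 1)) : Joined D a b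
  /-- the over-strand of a crossing, running from right to left -/
  | overLeft (a b : D.Point) (k i : ℕ) (hs : D.slices[k]? = some ⟨.cross false, i⟩)
      (ha : a.1 = (k, i + 1)) (hb : b.1 = (k + 1, i)) : Joined D a b

/-- The arcs of the diagram: maximal pieces that do not pass under a crossing (closed curves
without under-crossings included). -/
def Arc (D : LinkDiagram) : Type := Quot D.Joined

/-- The arc through a point. -/
def arc (D : LinkDiagram) (a : D.Point) : D.Arc := Quot.mk _ a

/-- `D.IsCrossing x y z`: at some crossing of `D`, `y` lies on the overpass and `x`, `z` lie on the
two underpasses (just below and just above the crossing). -/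
inductive IsCrossing (D : LinkDiagram) : D.Point → D.Point → D.Point → Prop
  | overRight (x y z : D.Point) (k i : ℕ) (hs : D.slices[k]? = some ⟨.cross true, i⟩)
      (hx : x.1 = (k, i + 1)) (hy : y.1 = (k, i)) (hz : z.1 = (k + 1, i)) : IsCrossing D x y z
  | overLeft (x y z : D.Point) (k i : ℕ) (hs : D.slices[k]? = some ⟨.cross false, i⟩)
      (hx : x.1 = (k, i)) (hy : y.1 = (k, i + 1)) (hz : z.1 = (k + 1, i + 1)) : IsCrossing D x y z

/-- The relators `y x⁻¹ y z⁻¹` of the associated core group, one for each crossing. -/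
def coreRelators (D : LinkDiagram) : Set (FreeGroup D.Arc) :=
  {g | ∃ x y z : D.Point, D.IsCrossing x y z ∧
    g = FreeGroup.of (D.arc y) * (FreeGroup.of (D.arc x))⁻¹ *
      FreeGroup.of (D.arc y) * (FreeGroup.of (D.arc z))⁻¹}

/-- The associated core group `Π_D^{(2)}`. -/
abbrev CoreGroup (D : LinkDiagram) : Type := PresentedGroup D.coreRelators

end LinkDiagram

/-! ### Links -/

/-- The local moves generating isotopy of links on diagrams in general position with respect to the
height: planar isotopies (`exchange`, `zigzag`, `slide`) and the three Reidemeister moves.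
A list of slices is read from bottom to top. -/
inductive LocalMove : List Slice → List Slice → Prop
  /-- two pieces side by side exchange their heights -/
  | exchange (s t : Piece) (i k : ℕ) :
      LocalMove [⟨s, i⟩, ⟨t, i + s.top + k⟩] [⟨t, i + s.bottom + k⟩, ⟨s, i⟩]
  /-- a neighbouring minimum and maximum are straightened -/
  | zigzagLeft (i : ℕ) : LocalMove [⟨.cup, i⟩, ⟨.cap, i + 1⟩] []
  | zigzagRight (i : ℕ) : LocalMove [⟨.cup, i + 1⟩, ⟨.cap, i⟩] []
  /-- a strand crossing one leg of a maximum is pushed over to the other leg -/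
  | slideCap (b : Bool) (i : ℕ) :
      LocalMove [⟨.cross b, i⟩, ⟨.cap, i + 1⟩] [⟨.cross !b, i + 1⟩, ⟨.cap, i⟩]
  /-- a strand crossing one leg of a minimum is pushed over to the other leg -/
  | slideCup (b : Bool) (i : ℕ) :
      LocalMove [⟨.cup, i⟩, ⟨.cross b, i + 1⟩] [⟨.cup, i + 1⟩, ⟨.cross !b, i⟩]
  /-- first Reidemeister move -/
  | reidemeister₁Cap (b : Bool) (i : ℕ) : LocalMove [⟨.cross b, i⟩, ⟨.cap, i⟩] [⟨.cap, i⟩]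
  | reidemeister₁Cup (b : Bool) (i : ℕ) : LocalMove [⟨.cup, i⟩, ⟨.cross b, i⟩] [⟨.cup, i⟩]
  /-- second Reidemeister move -/
  | reidemeister₂ (b : Bool) (i : ℕ) : LocalMove [⟨.cross b, i⟩, ⟨.cross !b, i⟩] []
  /-- third Reidemeister move -/
  | reidemeister₃ (b : Bool) (i : ℕ) :
      LocalMove [⟨.cross b, i⟩, ⟨.cross b, i + 1⟩, ⟨.cross b, i⟩]
        [⟨.cross b, i + 1⟩, ⟨.cross b, i⟩, ⟨.cross b, i + 1⟩]

/-- `D'` arises from `D` by replacing a block of consecutive slices according to `M`. -/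
def LinkDiagram.Replace (M : List Slice → List Slice → Prop) (D D' : LinkDiagram) : Prop :=
  ∃ u a b v : List Slice, M a b ∧ D.slices = u ++ a ++ v ∧ D'.slices = u ++ b ++ v

/-- Links (isotopy classes): diagrams up to the equivalence relation generated by planar isotopy
and Reidemeister moves. -/
def Link : Type := Quot (LinkDiagram.Replace LocalMove)

/-- The link represented by a diagram. -/
def LinkDiagram.link (D : LinkDiagram) : Link := Quot.mk _ D

/-- The local change of an `n`-move: two adjacent parallel strands are replaced by `n` half twists,
that is, by `n` crossings in a row of the same kind. -/
inductive NMoveLocal (n : ℕ) : List Slice → List Slice → Prop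
  | twist (b : Bool) (i : ℕ) : NMoveLocal n [] (List.replicate n ⟨.cross b, i⟩)

namespace Link

/-- `L'` arises from `L` by an `n`-move (on suitable diagrams). -/
def NMove (n : ℕ) (L L' : Link) : Prop :=
  ∃ D D' : LinkDiagram, D.link = L ∧ D'.link = L' ∧ LinkDiagram.Replace (NMoveLocal n) D D'

/-- `n`-move equivalence of links. -/
def NMoveEquiv (n : ℕ) : Link → Link → Prop := Relation.EqvGen (NMove n)

end Link

/-- `k` disjoint round circles, one above the other. -/
def trivialSlices : ℕ → List Slice
  | 0 => []
  | k + 1 => ⟨.cup, 0⟩ :: ⟨.cap, 0⟩ :: trivialSlices k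

theorem trivialSlices_fits (k : ℕ) : Fits 0 (trivialSlices k) := by
  induction k with
  | zero => rfl
  | succ k ih => exact ⟨by simp [Piece.bottom], by simp [Slice.next, Piece.bottom, Piece.top], ih⟩

/-- The trivial link with `k` components. -/
def Link.trivial (k : ℕ) : Link := LinkDiagram.link ⟨trivialSlices k, trivialSlices_fits k⟩

/-! ### Burnside groups -/

/-- The set `W_n` of all `n`-th powers in a free group. -/
def powerWords (α : Type) (n : ℕ) : Set (FreeGroup α) := {g | ∃ w : FreeGroup α, g = w ^ n}

/-- The group `⟨α ∣ R, W_n⟩`. -/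
abbrev BurnsideGroup {α : Type} (R : Set (FreeGroup α)) (n : ℕ) : Type :=
  PresentedGroup (R ∪ powerWords α n)

/-- The quotient `G / γ_q G` (`q ≥ 1`); Mathlib numbers the lower central series from `0`. -/
abbrev GammaQuotient (G : Type) [Group G] (q : ℕ) : Type :=
  G ⧸ Subgroup.lowerCentralSeries (⊤ : Subgroup G) (q - 1)

/-- The unreduced `n`-th Burnside group of the link with diagram `D`. -/
abbrev LinkDiagram.UnreducedBurnside (D : LinkDiagram) (n : ℕ) : Type :=
  BurnsideGroup D.coreRelators n

/-! ### Formal power series in non-commuting variables and the Magnus expansion -/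

/-- Formal power series over `R` in the non-commuting variables `X_i`, `i : σ`: a series is the
function sending a word `[i₁, …, i_k]` to the coefficient of `X_{i₁} ⋯ X_{i_k}`. -/
def NCPowerSeries (σ R : Type) : Type := List σ → R

namespace NCPowerSeries

variable {σ R : Type}

/-- The coefficient of the monomial given by the word `w`. -/
def coeff (w : List σ) (f : NCPowerSeries σ R) : R := f w

@[ext]
theorem ext {f g : NCPowerSeries σ R} (h : ∀ w, coeff w f = coeff w g) : f = g := funext h

/-- The series whose coefficient at `w` is that of `f` at `a :: w`. -/
def shift (a : σ) (f : NCPowerSeries σ R) : NCPowerSeries σ R := fun w => f (a :: w)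

@[simp] theorem coeff_shift (a : σ) (w : List σ) (f : NCPowerSeries σ R) :
    coeff w (shift a f) = coeff (a :: w) f := rfl

section Ring

variable [CommRing R]

instance : AddCommGroup (NCPowerSeries σ R) := inferInstanceAs (AddCommGroup (List σ → R))

instance : Module R (NCPowerSeries σ R) := inferInstanceAs (Module R (List σ → R))

instance : One (NCPowerSeries σ R) := ⟨fun w => if w.isEmpty then 1 else 0⟩

/-- Cauchy product: sum over all factorizations of a word into two words. -/
instance : Mul (NCPowerSeries σ R) :=
  ⟨fun f g w => ∑ k ∈ Finset.range (w.length + 1), f (w.take k) * g (w.drop k)⟩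

@[simp] theorem coeff_zero (w : List σ) : coeff w (0 : NCPowerSeries σ R) = 0 := rfl

@[simp] theorem coeff_add (w : List σ) (f g : NCPowerSeries σ R) :
    coeff w (f + g) = coeff w f + coeff w g := rfl

@[simp] theorem coeff_neg (w : List σ) (f : NCPowerSeries σ R) :
    coeff w (-f) = -coeff w f := rfl

@[simp] theorem coeff_smul (w : List σ) (c : R) (f : NCPowerSeries σ R) :
    coeff w (c • f) = c * coeff w f := rfl

@[simp] theorem coeff_one_nil : coeff [] (1 : NCPowerSeries σ R) = 1 := rfl

@[simp] theorem coeff_one_cons (a : σ) (w : List σ) :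
    coeff (a :: w) (1 : NCPowerSeries σ R) = 0 := rfl

theorem coeff_mul (w : List σ) (f g : NCPowerSeries σ R) :
    coeff w (f * g) =
      ∑ k ∈ Finset.range (w.length + 1), coeff (w.take k) f * coeff (w.drop k) g := rfl

@[simp] theorem coeff_mul_nil (f g : NCPowerSeries σ R) :
    coeff [] (f * g) = coeff [] f * coeff [] g := by
  simp [coeff_mul]

theorem coeff_mul_cons (a : σ) (w : List σ) (f g : NCPowerSeries σ R) :
    coeff (a :: w) (f * g) = coeff [] f * coeff (a :: w) g + coeff w (shift a f * g) := by
  rw [coeff_mul, coeff_mul, List.length_cons, Finset.sum_range_succ', add_comm]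
  simp

theorem shift_mul (a : σ) (f g : NCPowerSeries σ R) :
    shift a (f * g) = coeff [] f • shift a g + shift a f * g := by
  ext w
  simp [coeff_mul_cons]

protected theorem add_mul (f g h : NCPowerSeries σ R) : (f + g) * h = f * h + g * h := by
  ext w
  simp [coeff_mul, add_mul, Finset.sum_add_distrib]

protected theorem mul_add (f g h : NCPowerSeries σ R) : f * (g + h) = f * g + f * h := by
  ext w
  simp [coeff_mul, mul_add, Finset.sum_add_distrib]

protected theorem zero_mul (f : NCPowerSeries σ R) : 0 * f = 0 := by
  ext w
  simp [coeff_mul]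

protected theorem mul_zero (f : NCPowerSeries σ R) : f * 0 = 0 := by
  ext w
  simp [coeff_mul]

protected theorem smul_mul (c : R) (f g : NCPowerSeries σ R) : (c • f) * g = c • (f * g) := by
  ext w
  simp [coeff_mul, Finset.mul_sum, mul_assoc]

protected theorem one_mul (f : NCPowerSeries σ R) : 1 * f = f := by
  ext w
  cases w with
  | nil => simp
  | cons a w =>
    have h : shift a (1 : NCPowerSeries σ R) = 0 := rfl
    rw [coeff_mul_cons, h, NCPowerSeries.zero_mul]
    simp

protected theorem mul_one (f : NCPowerSeries σ R) : f * 1 = f := by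
  ext w
  induction w generalizing f with
  | nil => simp
  | cons a w ih => simp [coeff_mul_cons, ih]

protected theorem mul_assoc (f g h : NCPowerSeries σ R) : f * g * h = f * (g * h) := by
  ext w
  induction w generalizing f g h with
  | nil => simp [mul_assoc]
  | cons a w ih =>
    rw [coeff_mul_cons, coeff_mul_cons, shift_mul, NCPowerSeries.add_mul, coeff_add, ih,
      NCPowerSeries.smul_mul, coeff_smul, coeff_mul_nil, coeff_mul_cons a w g h]
    ring

instance : Ring (NCPowerSeries σ R) where
  __ := (inferInstance : AddCommGroup (NCPowerSeries σ R))
  mul_assoc := NCPowerSeries.mul_assoc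
  one_mul := NCPowerSeries.one_mul
  mul_one := NCPowerSeries.mul_one
  left_distrib := NCPowerSeries.mul_add
  right_distrib := NCPowerSeries.add_mul
  zero_mul := NCPowerSeries.zero_mul
  mul_zero := NCPowerSeries.mul_zero

variable [DecidableEq σ]

/-- The variable `X_i`. -/
def X (i : σ) : NCPowerSeries σ R := fun w => if w = [i] then 1 else 0

/-- The alternating series `1 - X_i + X_i² - X_i³ + ⋯`. -/
def altX (i : σ) : NCPowerSeries σ R :=
  fun w => if w = List.replicate w.length i then (-1) ^ w.length else 0

theorem coeff_X (i : σ) (w : List σ) :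
    coeff w (X i : NCPowerSeries σ R) = if w = [i] then 1 else 0 := rfl

theorem coeff_altX (i : σ) (w : List σ) :
    coeff w (altX i : NCPowerSeries σ R) =
      if w = List.replicate w.length i then (-1) ^ w.length else 0 := rfl

theorem shift_X (a i : σ) :
    shift a (X i : NCPowerSeries σ R) = if a = i then 1 else 0 := by
  ext w
  cases w <;> by_cases h : a = i <;> simp [coeff_X, h]

theorem shift_altX (a i : σ) :
    shift a (altX i : NCPowerSeries σ R) = if a = i then -altX i else 0 := by
  ext w
  by_cases h : a = i
  · by_cases hw : w = List.replicate w.length i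
    · simp [coeff_altX, h, List.replicate_succ, ← hw, pow_succ]
    · simp [coeff_altX, h, List.replicate_succ, hw]
  · simp [coeff_altX, h, List.replicate_succ]

theorem one_add_X_mul_altX (i : σ) : (1 + X i) * altX i = (1 : NCPowerSeries σ R) := by
  ext w
  cases w with
  | nil => simp [coeff_X, coeff_altX]
  | cons a w =>
    have h : shift a (1 + X i : NCPowerSeries σ R) = if a = i then 1 else 0 := by
      rw [← shift_X]
      ext w
      simp
    rw [coeff_mul_cons, h, ← coeff_shift a w (altX i), shift_altX]
    by_cases ha : a = i <;> simp [coeff_X, ha]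

theorem altX_mul_one_add_X (i : σ) : altX i * (1 + X i) = (1 : NCPowerSeries σ R) := by
  ext w
  induction w with
  | nil => simp [coeff_X, coeff_altX]
  | cons a w ih =>
    rw [coeff_mul_cons, shift_altX]
    by_cases ha : a = i
    · rw [if_pos ha, neg_mul, coeff_neg, ih]
      cases w <;> simp [coeff_X, coeff_altX, ha]
    · simp [coeff_X, ha]

/-- The unit `1 + X_i`, with inverse `1 - X_i + X_i² - ⋯`. -/
def oneAddX (i : σ) : (NCPowerSeries σ R)ˣ :=
  ⟨1 + X i, altX i, one_add_X_mul_altX i, altX_mul_one_add_X i⟩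

end Ring

end NCPowerSeries

/-- The Magnus `ℤ/p`-expansion of the free group on `x_1, …, x_m`: the homomorphism with
`x_i ↦ 1 + X_i` and `x_i⁻¹ ↦ 1 - X_i + X_i² - ⋯`. -/
def magnus (p m : ℕ) : FreeGroup (Fin m) →* NCPowerSeries (Fin m) (ZMod p) :=
  (Units.coeHom _).comp (FreeGroup.lift NCPowerSeries.oneAddX)

/-! The proof counts homomorphisms. For a group `G`, homomorphisms from the core group of a diagram
to `G` are colourings of its arcs by `G`, and their number is a link invariant: each local move
leaves the colourings with given boundary colours in bijection (`LocalMove.traceEquiv`). Along a row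
of `n` half twists two strands coloured `a`, `b` get multiplied on the left by the `n`-th power of
`ab⁻¹` or `ba⁻¹`, so if `G` has exponent `p`, the count is also unchanged by `p`-moves
(`NMoveLocal.traceEquiv`). A link that is `p`-move equivalent to the trivial link with `k`
components therefore has `|G|^k` colourings when `G` is finite of exponent `p`.

For `G = ℤ/p` the surjection from the core group onto `(ℤ/p)^m` gives at least `p^m` homomorphisms,
hence `m ≤ k`. For general `G` the homomorphisms are the maps `Fin m → G` killing `R`; there are
`|G|^k ≥ |G|^m` of them, so every map kills `R`. Each relator is thus a law of every finite group of
exponent `p` (`lift_eq_one_of_nMoveEquiv_trivial`).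

The theorem follows from one such group: the series with constant term 1, modulo those `1 + f` with
`f` of order at least `p` and symmetric in degree `p`. Its exponent divides `p` because `(1 + f)^p =
1 + f^p` in characteristic `p`, and the degree `p` coefficients of `f^p` are products of linear
coefficients of `f`, which commute. -/

/-! ### Colourings of stacks of slices

A colouring of a stack of slices by a group `G` assigns to each level a function `ℕ → G`; the
values at the positions beyond the last strand are kept, and are `1` for a link diagram. -/

section Coloring

variable {G : Type} [Group G]

/-- The colouring rule of a piece; only the first `bottom` (`top`) values of `l` (`l'`) matter. -/
def Piece.Rule : Piece → (ℕ → G) → (ℕ → G) → Prop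
  | .cup, _, l' => l' 0 = l' 1
  | .cap, l, _ => l 0 = l 1
  | .cross true, l, l' => l' 1 = l 0 ∧ l' 0 = l 0 * (l 1)⁻¹ * l 0
  | .cross false, l, l' => l' 0 = l 1 ∧ l' 1 = l 1 * (l 0)⁻¹ * l 1

theorem Piece.Rule.congr {s : Piece} {l l' m m' : ℕ → G} (h : s.Rule l l')
    (hb : ∀ j < s.bottom, m j = l j) (ht : ∀ j < s.top, m' j = l' j) : s.Rule m m' := by
  rcases s with _ | _ | (_ | _) <;> simp_all [Piece.Rule, Piece.bottom, Piece.top]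

/-- `l` and `l'` colour the lower and the upper boundary of the slice `s` compatibly. -/
structure Slice.Step (s : Slice) (l l' : ℕ → G) : Prop where
  left : ∀ j < s.left, l' j = l j
  right : ∀ j, l' (s.left + s.piece.top + j) = l (s.left + s.piece.bottom + j)
  rule : s.piece.Rule (fun j => l (s.left + j)) (fun j => l' (s.left + j))

/-- Colourings of a stack of slices with prescribed colours below and above. -/
def Trace : List Slice → (ℕ → G) → (ℕ → G) → Type
  | [], l, t => PLift (l = t)
  | s :: w, l, t => Σ m : {m : ℕ → G // s.Step l m}, Trace w m t

/-- The effect of a crossing on the colours. -/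
def crossMap (b : Bool) (i : ℕ) (l : ℕ → G) : ℕ → G := fun j =>
  if j = i then (if b then l i * (l (i + 1))⁻¹ * l i else l (i + 1))
  else if j = i + 1 then (if b then l i else l (i + 1) * (l i)⁻¹ * l (i + 1))
  else l j

/-- Forget the colours of the strands `i` and `i + 1`. -/
def dropTwo (i : ℕ) (l : ℕ → G) : ℕ → G := fun j => if j < i then l j else l (j + 2)

/-! ### Slices as equations between neighbouring levels -/

theorem step_cross_iff {b : Bool} {i : ℕ} {l l' : ℕ → G} :
    Slice.Step ⟨.cross b, i⟩ l l' ↔ l' = crossMap b i l := by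
  constructor
  · intro h
    funext j
    have hl := h.left j
    have hr := h.right (j - (i + 2))
    have hu := h.rule
    simp only [Piece.bottom, Piece.top] at hl hr
    unfold crossMap
    split_ifs with h1 hb h1 hb
    · subst hb; subst h1; simpa using hu.2
    · simp only [Bool.not_eq_true] at hb; subst hb; subst h1; simpa using hu.1
    · subst hb; subst h1; simpa using hu.1
    · simp only [Bool.not_eq_true] at hb; subst hb; subst h1; simpa using hu.2
    · by_cases hj : j < i
      · exact hl hj
      · rwa [show i + 2 + (j - (i + 2)) = j by omega] at hr
  · rintro rfl
    refine ⟨fun j hj => ?_, fun j => ?_, ?_⟩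
    · simp only at hj
      simp [crossMap, show j ≠ i by omega, show j ≠ i + 1 by omega]
    · simp only [Piece.bottom, Piece.top]
      simp [crossMap, show i + 2 + j ≠ i by omega, show i + 2 + j ≠ i + 1 by omega]
    · cases b <;> simp [Piece.Rule, crossMap]

/-- Across a minimum the upper level determines the lower one; across a maximum the roles are
reversed, and a crossing is invertible. Most local moves can therefore be checked by solving for the
middle level. -/
theorem step_cup_iff {i : ℕ} {l l' : ℕ → G} :
    Slice.Step ⟨.cup, i⟩ l l' ↔ l = dropTwo i l' ∧ l' i = l' (i + 1) := by
  constructor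
  · intro h
    refine ⟨funext fun j => ?_, h.rule⟩
    have hl := h.left j
    have hr := h.right (j - i)
    simp only [Piece.bottom, Piece.top] at hl hr
    unfold dropTwo
    split_ifs with hj
    · exact (hl hj).symm
    · rw [show i + 2 + (j - i) = j + 2 by omega, show i + 0 + (j - i) = j by omega] at hr
      exact hr.symm
  · rintro ⟨rfl, h⟩
    refine ⟨fun j hj => ?_, fun j => ?_, h⟩
    · simp only at hj
      simp [dropTwo, hj]
    · simp only [Piece.bottom, Piece.top]
      simp [dropTwo, add_right_comm]

theorem step_cap_iff {i : ℕ} {l l' : ℕ → G} :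
    Slice.Step ⟨.cap, i⟩ l l' ↔ l' = dropTwo i l ∧ l i = l (i + 1) := by
  constructor
  · intro h
    refine ⟨funext fun j => ?_, h.rule⟩
    have hl := h.left j
    have hr := h.right (j - i)
    simp only [Piece.bottom, Piece.top] at hl hr
    unfold dropTwo
    split_ifs with hj
    · exact hl hj
    · rwa [show i + 2 + (j - i) = j + 2 by omega, show i + 0 + (j - i) = j by omega] at hr
  · rintro ⟨rfl, h⟩
    refine ⟨fun j hj => ?_, fun j => ?_, h⟩
    · simp only at hj
      simp [dropTwo, hj]
    · simp only [Piece.bottom, Piece.top]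
      simp [dropTwo, add_right_comm]

theorem crossMap_crossMap_not (b : Bool) (i : ℕ) (l : ℕ → G) :
    crossMap (!b) i (crossMap b i l) = l := by
  funext j
  by_cases h1 : j = i
  · subst h1; cases b <;> simp [crossMap, mul_assoc]
  · by_cases h2 : j = i + 1
    · subst h2; cases b <;> simp [crossMap, mul_assoc]
    · simp [crossMap, h1, h2]

theorem eq_crossMap_iff {b : Bool} {i : ℕ} {l l' : ℕ → G} :
    l' = crossMap b i l ↔ l = crossMap (!b) i l' := by
  constructor
  · rintro rfl; rw [crossMap_crossMap_not]
  · rintro rfl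
    have h := crossMap_crossMap_not (!b) i l'
    rw [Bool.not_not] at h
    exact h.symm

/-! #### Stacking -/

/-- A colouring of a stack of two stacks. -/
def traceAppend : (u v : List Slice) → (l l' : ℕ → G) →
    Trace (u ++ v) l l' ≃ Σ m, Trace u l m × Trace v m l'
  | [], v, l, l' =>
    { toFun := fun t => ⟨l, ⟨rfl⟩, t⟩
      invFun := fun t => t.2.1.down ▸ t.2.2
      left_inv := fun _ => rfl
      right_inv := by rintro ⟨m, ⟨rfl⟩, t⟩; rfl }
  | s :: u, v, l, l' =>
    (Equiv.sigmaCongrRight fun m : {m : ℕ → G // s.Step l m} => traceAppend u v m.1 l').trans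
      { toFun := fun t => ⟨t.2.1, ⟨t.1, t.2.2.1⟩, t.2.2.2⟩
        invFun := fun t => ⟨t.2.1.1, t.1, t.2.1.2, t.2.2⟩
        left_inv := fun _ => rfl
        right_inv := fun _ => rfl }

/-- Stacks with the same colourings, for any colours on the boundary. -/
def TraceEquiv (G : Type) [Group G] (a b : List Slice) : Prop :=
  ∀ l l' : ℕ → G, Nonempty (Trace a l l' ≃ Trace b l l')

/-- A colouring of a stack splits at any intermediate level, so a local bijection for all boundary
colours extends by the identity above and below. -/
theorem TraceEquiv.replace {a b : List Slice} (h : TraceEquiv G a b) (u v : List Slice) :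
    TraceEquiv G (u ++ a ++ v) (u ++ b ++ v) := by
  intro l l'
  have e := fun m m' => (h m m').some
  refine ⟨(traceAppend _ _ _ _).trans (Equiv.trans ?_ (traceAppend _ _ _ _).symm)⟩
  refine Equiv.sigmaCongrRight fun m => Equiv.prodCongr ?_ (Equiv.refl _)
  refine (traceAppend _ _ _ _).trans (Equiv.trans ?_ (traceAppend _ _ _ _).symm)
  exact Equiv.sigmaCongrRight fun m' => Equiv.prodCongr (Equiv.refl _) (e _ _)

/-! #### Rigid stacks -/

theorem nonempty_trace_cons {s : Slice} {w : List Slice} {l l' : ℕ → G} :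
    Nonempty (Trace (s :: w) l l') ↔ ∃ m, s.Step l m ∧ Nonempty (Trace w m l') :=
  ⟨fun ⟨⟨m, t⟩⟩ => ⟨m.1, m.2, ⟨t⟩⟩, fun ⟨m, h, ⟨t⟩⟩ => ⟨⟨⟨m, h⟩, t⟩⟩⟩

theorem nonempty_trace_nil {l l' : ℕ → G} : Nonempty (Trace [] l l') ↔ l = l' :=
  ⟨fun ⟨⟨h⟩⟩ => h, fun h => ⟨⟨h⟩⟩⟩

theorem nonempty_trace_singleton {s : Slice} {l l' : ℕ → G} :
    Nonempty (Trace [s] l l') ↔ s.Step l l' := by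
  simp [nonempty_trace_cons, nonempty_trace_nil]

theorem nonempty_trace_pair {s t : Slice} {l l' : ℕ → G} :
    Nonempty (Trace [s, t] l l') ↔ ∃ m, s.Step l m ∧ t.Step m l' := by
  simp [nonempty_trace_cons, nonempty_trace_nil]

instance subsingleton_trace_nil (l l' : ℕ → G) : Subsingleton (Trace [] l l') :=
  inferInstanceAs (Subsingleton (PLift (l = l')))

/-- In the local moves the boundary colours leave at most one colouring of the block. A bijection of
colourings then reduces to both sides being colourable for the same boundary colours. -/
theorem subsingleton_trace_cons {s : Slice} {w : List Slice} {l l' : ℕ → G}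
    (hw : ∀ m, Subsingleton (Trace w m l'))
    (h : ∀ m m', s.Step l m → s.Step l m' → Nonempty (Trace w m l') → Nonempty (Trace w m' l') →
      m = m') : Subsingleton (Trace (s :: w) l l') := by
  constructor
  rintro ⟨⟨m, hm⟩, t⟩ ⟨⟨m', hm'⟩, t'⟩
  obtain rfl := h m m' hm hm' ⟨t⟩ ⟨t'⟩
  rw [Subsingleton.elim t t']

instance subsingleton_trace_singleton (s : Slice) (l l' : ℕ → G) :
    Subsingleton (Trace [s] l l') :=
  subsingleton_trace_cons (fun _ => inferInstance) fun _ _ _ _ h h' =>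
    (nonempty_trace_nil.1 h).trans (nonempty_trace_nil.1 h').symm

theorem subsingleton_trace_pair {s t : Slice} {l l' : ℕ → G}
    (h : ∀ m m', s.Step l m → s.Step l m' → t.Step m l' → t.Step m' l' → m = m') :
    Subsingleton (Trace [s, t] l l') :=
  subsingleton_trace_cons (fun _ => inferInstance) fun m m' hm hm' ht ht' =>
    h m m' hm hm' (nonempty_trace_singleton.1 ht) (nonempty_trace_singleton.1 ht')

theorem nonempty_equiv_of_subsingleton {α β : Type} (ha : Subsingleton α) (hb : Subsingleton β)
    (h : Nonempty α ↔ Nonempty β) : Nonempty (α ≃ β) :=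
  ⟨{ toFun := fun a => (h.1 ⟨a⟩).some
     invFun := fun b => (h.2 ⟨b⟩).some
     left_inv := fun _ => Subsingleton.elim _ _
     right_inv := fun _ => Subsingleton.elim _ _ }⟩

/-- The effect of a row of crossings on the colours. -/
theorem trace_crossings (w : List (Bool × ℕ)) (l l' : ℕ → G) :
    Subsingleton (Trace (w.map fun x => ⟨.cross x.1, x.2⟩) l l') ∧
      (Nonempty (Trace (w.map fun x => ⟨.cross x.1, x.2⟩) l l') ↔
        w.foldl (fun l x => crossMap x.1 x.2 l) l = l') := by
  induction w generalizing l with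
  | nil => exact ⟨subsingleton_trace_nil _ _, nonempty_trace_nil⟩
  | cons x w ih =>
    refine ⟨subsingleton_trace_cons (fun m => (ih m).1) fun m m' h h' _ _ => ?_, ?_⟩
    · rw [step_cross_iff] at h h'
      rw [h, h']
    · rw [List.map_cons, nonempty_trace_cons]
      simp [step_cross_iff, ih]

theorem traceEquiv_crossings {w w' : List (Bool × ℕ)}
    (h : ∀ l : ℕ → G, w.foldl (fun l x => crossMap x.1 x.2 l) l =
      w'.foldl (fun l x => crossMap x.1 x.2 l) l) :
    TraceEquiv G (w.map fun x => ⟨.cross x.1, x.2⟩) (w'.map fun x => ⟨.cross x.1, x.2⟩) :=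
  fun l l' => nonempty_equiv_of_subsingleton (trace_crossings _ _ _).1 (trace_crossings _ _ _).1
    (by rw [(trace_crossings _ _ _).2, (trace_crossings _ _ _).2, h])

/-! #### Local moves -/

theorem traceEquiv_exchange (s t : Piece) (i k : ℕ) :
    TraceEquiv G [⟨s, i⟩, ⟨t, i + s.top + k⟩] [⟨t, i + s.bottom + k⟩, ⟨s, i⟩] := by
  intro l l'
  refine nonempty_equiv_of_subsingleton (subsingleton_trace_pair ?_) (subsingleton_trace_pair ?_) ?_
  · intro m m' hm hm' ht ht'
    funext j
    rcases lt_or_ge j (i + s.top + k) with hj | hj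
    · exact (ht.left j hj).symm.trans (ht'.left j hj)
    · obtain ⟨n, rfl⟩ := Nat.exists_eq_add_of_le hj
      have h := hm.right (k + n)
      have h' := hm'.right (k + n)
      simp only [← add_assoc] at h h'
      exact h.trans h'.symm
  · intro m m' hm hm' ht ht'
    funext j
    rcases lt_or_ge j (i + s.bottom + k) with hj | hj
    · exact (hm.left j hj).trans (hm'.left j hj).symm
    · obtain ⟨n, rfl⟩ := Nat.exists_eq_add_of_le hj
      have h := ht.right (k + n)
      have h' := ht'.right (k + n)
      simp only [← add_assoc] at h h'
      exact h.symm.trans h'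
  · rw [nonempty_trace_pair, nonempty_trace_pair]
    constructor
    · rintro ⟨m, hs, ht⟩
      have hs1 : ∀ j < i, m j = l j := hs.left
      have hs2 : ∀ j, m (i + s.top + j) = l (i + s.bottom + j) := hs.right
      have ht1 : ∀ j < i + s.top + k, l' j = m j := ht.left
      have ht2 : ∀ j, l' (i + s.top + k + t.top + j) = m (i + s.top + k + t.bottom + j) := ht.right
      -- The new middle level has `t` done and `s` not yet: it agrees with the bottom level left of
      -- `t`, and with the top level, shifted, from there on.
      let m' : ℕ → G := fun j => if j < i + s.bottom + k then l j else
        l' (i + s.top + k + (j - (i + s.bottom + k)))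
      have m'1 : ∀ j < i + s.bottom + k, m' j = l j := fun j hj => if_pos hj
      have m'2 : ∀ j, m' (i + s.bottom + k + j) = l' (i + s.top + k + j) := fun j => by
        simp [m']
      refine ⟨m', ⟨m'1, fun j => ?_, ht.rule.congr (fun j _ => ?_) (fun j _ => ?_)⟩,
        ⟨fun j hj => ?_, fun j => ?_, hs.rule.congr (fun j (hj : j < s.bottom) => ?_)
          (fun j (hj : j < s.top) => ?_)⟩⟩
      · simp only
        rw [add_assoc _ t.top, m'2, ← add_assoc, ht2]
        simpa only [add_assoc] using hs2 (k + (t.bottom + j))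
      · simpa only [add_assoc] using (hs2 (k + j)).symm
      · simp only [m'2]
      · simp only at hj ⊢
        rw [m'1 _ (by omega), ht1 _ (by omega), hs1 _ hj]
      · simp only
        rcases lt_or_ge j k with hj | hj
        · rw [m'1 _ (by omega), ht1 _ (by omega), hs2]
        · obtain ⟨n, rfl⟩ := Nat.exists_eq_add_of_le hj
          rw [← add_assoc, ← add_assoc, m'2]
      · exact m'1 _ (by simp only; omega)
      · exact ht1 _ (by simp only; omega)
    · rintro ⟨m, ht, hs⟩
      have hs1 : ∀ j < i, l' j = m j := hs.left
      have hs2 : ∀ j, l' (i + s.top + j) = m (i + s.bottom + j) := hs.right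
      have ht1 : ∀ j < i + s.bottom + k, m j = l j := ht.left
      have ht2 : ∀ j, m (i + s.bottom + k + t.top + j) = l (i + s.bottom + k + t.bottom + j) :=
        ht.right
      let m' : ℕ → G := fun j => if j < i + s.top + k then l' j else
        l (i + s.bottom + k + (j - (i + s.top + k)))
      have m'1 : ∀ j < i + s.top + k, m' j = l' j := fun j hj => if_pos hj
      have m'2 : ∀ j, m' (i + s.top + k + j) = l (i + s.bottom + k + j) := fun j => by
        simp [m']
      refine ⟨m', ⟨fun j hj => ?_, fun j => ?_, hs.rule.congr (fun j (hj : j < s.bottom) => ?_)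
          (fun j (hj : j < s.top) => ?_)⟩,
        ⟨fun j hj => (m'1 j hj).symm, fun j => ?_,
          ht.rule.congr (fun j _ => ?_) (fun j _ => ?_)⟩⟩
      · simp only at hj ⊢
        rw [m'1 _ (by omega), hs1 _ hj, ht1 _ (by omega)]
      · simp only
        rcases lt_or_ge j k with hj | hj
        · rw [m'1 _ (by omega), hs2, ht1 _ (by omega)]
        · obtain ⟨n, rfl⟩ := Nat.exists_eq_add_of_le hj
          rw [← add_assoc, ← add_assoc, m'2]
      · exact (ht1 _ (by simp only; omega)).symm
      · exact m'1 _ (by simp only; omega)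
      · simp only
        rw [add_assoc _ t.bottom, m'2, ← add_assoc, ← ht2]
        simpa only [add_assoc] using hs2 (k + (t.top + j))
      · simp only [m'2]
      · simpa only [add_assoc] using hs2 (k + j)

theorem traceEquiv_zigzagLeft (i : ℕ) : TraceEquiv G [⟨.cup, i⟩, ⟨.cap, i + 1⟩] [] := by
  intro l l'
  refine nonempty_equiv_of_subsingleton (subsingleton_trace_pair ?_) inferInstance ?_
  · simp only [step_cup_iff, step_cap_iff]
    rintro m m' ⟨h1, h2⟩ ⟨h1', h2'⟩ ⟨h3, h4⟩ ⟨h3', h4'⟩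
    funext j
    have e : ∀ j, dropTwo i m j = dropTwo i m' j := fun j => by rw [← h1, ← h1']
    have e2 := e i
    have e3 := e j
    have e4 := e (j - 2)
    simp only [dropTwo, lt_irrefl, if_false] at e2 e3 e4
    grind
  · rw [nonempty_trace_pair, nonempty_trace_nil]
    simp only [step_cup_iff, step_cap_iff]
    constructor
    · rintro ⟨m, ⟨rfl, h1⟩, rfl, h2⟩
      funext j
      simp only [dropTwo]
      grind
    · rintro rfl
      -- The middle level repeats strand `i` three times, at positions `i`, `i + 1` and `i + 2`.
      refine ⟨fun j => if j < i + 1 then l j else if j = i + 1 then l i else l (j - 2),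
        ⟨funext fun j => ?_, ?_⟩, funext fun j => ?_, ?_⟩
      all_goals simp only [dropTwo]; grind

theorem traceEquiv_zigzagRight (i : ℕ) : TraceEquiv G [⟨.cup, i + 1⟩, ⟨.cap, i⟩] [] := by
  intro l l'
  refine nonempty_equiv_of_subsingleton (subsingleton_trace_pair ?_) inferInstance ?_
  · simp only [step_cup_iff, step_cap_iff]
    rintro m m' ⟨h1, h2⟩ ⟨h1', h2'⟩ ⟨h3, h4⟩ ⟨h3', h4'⟩
    funext j
    have e : ∀ j, dropTwo (i + 1) m j = dropTwo (i + 1) m' j := fun j => by rw [← h1, ← h1']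
    have e2 := e i
    have e3 := e j
    have e4 := e (j - 2)
    simp only [dropTwo] at e2 e3 e4
    grind
  · rw [nonempty_trace_pair, nonempty_trace_nil]
    simp only [step_cup_iff, step_cap_iff]
    constructor
    · rintro ⟨m, ⟨rfl, h1⟩, rfl, h2⟩
      funext j
      simp only [dropTwo]
      grind
    · rintro rfl
      refine ⟨fun j => if j < i + 1 then l j else if j = i + 1 then l i else l (j - 2),
        ⟨funext fun j => ?_, ?_⟩, funext fun j => ?_, ?_⟩
      all_goals simp only [dropTwo]; grind

theorem mul_inv_mul_eq_comm {a b c : G} : b * a⁻¹ * b = c ↔ a = b * c⁻¹ * b := by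
  constructor <;> rintro rfl <;> group

/-- The core relation `z = y x⁻¹ y` is symmetric in the two underpasses `x` and `z`, so it does not
matter from which leg the crossing is read. -/
theorem crossMap_slide_cond (b : Bool) (i : ℕ) (l : ℕ → G) :
    crossMap b i l (i + 1) = crossMap b i l (i + 1 + 1) ↔
      crossMap (!b) (i + 1) l i = crossMap (!b) (i + 1) l (i + 1) := by
  cases b <;> simp [crossMap, mul_inv_mul_eq_comm, show i ≠ i + 1 + 1 by omega,
    show i + 1 + 1 ≠ i by omega]

theorem dropTwo_crossMap_slide (b : Bool) (i : ℕ) (l : ℕ → G)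
    (h : crossMap b i l (i + 1) = crossMap b i l (i + 1 + 1)) :
    dropTwo (i + 1) (crossMap b i l) = dropTwo i (crossMap (!b) (i + 1) l) := by
  funext j
  rcases lt_trichotomy j i with hj | rfl | hj
  · simp [dropTwo, crossMap, hj, hj.ne, show j ≠ i + 1 by omega, show j < i + 1 by omega,
      show j ≠ i + 2 by omega]
  · cases b
    · simp [dropTwo, crossMap]
    · have h' : l j = l (j + 2) := by simpa [crossMap, show j + 1 + 1 ≠ j by omega] using h
      simp [dropTwo, crossMap, h']
  · simp [dropTwo, crossMap, show ¬ j < i by omega, show ¬ j < i + 1 by omega,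
      show j + 2 ≠ i by omega, show j + 1 ≠ i by omega, show j ≠ i by omega]

theorem dropTwo_crossMap (b : Bool) (i : ℕ) (l : ℕ → G) :
    dropTwo i (crossMap b i l) = dropTwo i l := by
  funext j
  unfold dropTwo crossMap
  grind

/-- The first Reidemeister move: `a b⁻¹ a = a` exactly when `a = b`, so the kink imposes no
condition beyond that of the extremum. -/
theorem crossMap_cond (b : Bool) (i : ℕ) (l : ℕ → G) :
    crossMap b i l i = crossMap b i l (i + 1) ↔ l i = l (i + 1) := by
  cases b
  · simp only [crossMap, if_true, Bool.false_eq_true, if_false, Nat.succ_ne_self, mul_assoc,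
      left_eq_mul, inv_mul_eq_one]
  · simp only [crossMap, if_true, Nat.succ_ne_self, if_false, mul_assoc, mul_eq_left,
      inv_mul_eq_one]
    exact eq_comm

theorem traceEquiv_slideCap (b : Bool) (i : ℕ) :
    TraceEquiv G [⟨.cross b, i⟩, ⟨.cap, i + 1⟩] [⟨.cross !b, i + 1⟩, ⟨.cap, i⟩] := by
  intro l l'
  refine nonempty_equiv_of_subsingleton (subsingleton_trace_pair ?_) (subsingleton_trace_pair ?_) ?_
  · simp only [step_cross_iff]
    exact fun _ _ h h' _ _ => h.trans h'.symm
  · simp only [step_cross_iff]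
    exact fun _ _ h h' _ _ => h.trans h'.symm
  · rw [nonempty_trace_pair, nonempty_trace_pair]
    simp only [step_cross_iff, step_cap_iff, exists_eq_left, ← crossMap_slide_cond]
    exact and_congr_left fun h => by rw [dropTwo_crossMap_slide b i l h]

theorem traceEquiv_slideCup (b : Bool) (i : ℕ) :
    TraceEquiv G [⟨.cup, i⟩, ⟨.cross b, i + 1⟩] [⟨.cup, i + 1⟩, ⟨.cross !b, i⟩] := by
  intro l l'
  refine nonempty_equiv_of_subsingleton (subsingleton_trace_pair ?_) (subsingleton_trace_pair ?_) ?_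
  · simp only [step_cross_iff, eq_crossMap_iff (l' := l')]
    exact fun _ _ _ _ h h' => h.trans h'.symm
  · simp only [step_cross_iff, eq_crossMap_iff (l' := l')]
    exact fun _ _ _ _ h h' => h.trans h'.symm
  · rw [nonempty_trace_pair, nonempty_trace_pair]
    simp only [step_cross_iff, step_cup_iff, eq_crossMap_iff (l' := l'), exists_eq_right,
      Bool.not_not, ← crossMap_slide_cond]
    exact and_congr_left fun h => by rw [dropTwo_crossMap_slide b i l' h]

theorem traceEquiv_reidemeister₁Cap (b : Bool) (i : ℕ) :
    TraceEquiv G [⟨.cross b, i⟩, ⟨.cap, i⟩] [⟨.cap, i⟩] := by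
  intro l l'
  refine nonempty_equiv_of_subsingleton (subsingleton_trace_pair ?_) inferInstance ?_
  · simp only [step_cross_iff]
    exact fun _ _ h h' _ _ => h.trans h'.symm
  · rw [nonempty_trace_pair, nonempty_trace_singleton]
    simp only [step_cross_iff, step_cap_iff, exists_eq_left, dropTwo_crossMap, crossMap_cond]

theorem traceEquiv_reidemeister₁Cup (b : Bool) (i : ℕ) :
    TraceEquiv G [⟨.cup, i⟩, ⟨.cross b, i⟩] [⟨.cup, i⟩] := by
  intro l l'
  refine nonempty_equiv_of_subsingleton (subsingleton_trace_pair ?_) inferInstance ?_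
  · simp only [step_cross_iff, eq_crossMap_iff (l' := l')]
    exact fun _ _ _ _ h h' => h.trans h'.symm
  · rw [nonempty_trace_pair, nonempty_trace_singleton]
    simp only [step_cross_iff, step_cup_iff, eq_crossMap_iff (l' := l'), exists_eq_right,
      dropTwo_crossMap, crossMap_cond]

theorem traceEquiv_reidemeister₂ (b : Bool) (i : ℕ) :
    TraceEquiv G [⟨.cross b, i⟩, ⟨.cross !b, i⟩] [] :=
  traceEquiv_crossings (w := [(b, i), (!b, i)]) (w' := []) fun l => crossMap_crossMap_not b i l

theorem traceEquiv_reidemeister₃ (b : Bool) (i : ℕ) :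
    TraceEquiv G [⟨.cross b, i⟩, ⟨.cross b, i + 1⟩, ⟨.cross b, i⟩]
      [⟨.cross b, i + 1⟩, ⟨.cross b, i⟩, ⟨.cross b, i + 1⟩] := by
  refine traceEquiv_crossings (w := [(b, i), (b, i + 1), (b, i)])
    (w' := [(b, i + 1), (b, i), (b, i + 1)]) fun l => funext fun j => ?_
  simp only [List.foldl_cons, List.foldl_nil]
  by_cases h0 : j = i
  · subst h0; cases b <;> simp [crossMap, mul_assoc, show j ≠ j + 1 + 1 by omega,
      show j + 1 + 1 ≠ j by omega]
  by_cases h1 : j = i + 1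
  · subst h1; cases b <;> simp [crossMap, mul_assoc, show i ≠ i + 1 + 1 by omega,
      show i + 1 + 1 ≠ i by omega]
  by_cases h2 : j = i + 2
  · subst h2; cases b <;> simp [crossMap, mul_assoc, show i ≠ i + 1 + 1 by omega]
  · simp [crossMap, h0, h1, h2]

theorem LocalMove.traceEquiv {a b : List Slice} (h : LocalMove a b) : TraceEquiv G a b := by
  cases h with
  | exchange s t i k => exact traceEquiv_exchange s t i k
  | zigzagLeft i => exact traceEquiv_zigzagLeft i
  | zigzagRight i => exact traceEquiv_zigzagRight i
  | slideCap b i => exact traceEquiv_slideCap b i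
  | slideCup b i => exact traceEquiv_slideCup b i
  | reidemeister₁Cap b i => exact traceEquiv_reidemeister₁Cap b i
  | reidemeister₁Cup b i => exact traceEquiv_reidemeister₁Cup b i
  | reidemeister₂ b i => exact traceEquiv_reidemeister₂ b i
  | reidemeister₃ b i => exact traceEquiv_reidemeister₃ b i

/-! #### Twists -/

/-- One crossing sends `(a, b)` to `(ab⁻¹a, a)`, which is left multiplication of both colours by
`ab⁻¹`. The new pair has the same quotient `ab⁻¹`, so iteration just raises this factor to a power.
-/
theorem crossMap_true_iterate (i n : ℕ) (l : ℕ → G) :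
    (crossMap true i)^[n] l = fun j => if j = i ∨ j = i + 1 then
      (l i * (l (i + 1))⁻¹) ^ n * l j else l j := by
  induction n with
  | zero => simp
  | succ n ih =>
    rw [Function.iterate_succ_apply', ih]
    funext j
    by_cases h0 : j = i
    · subst h0; simp [crossMap, pow_succ, mul_assoc]
    · by_cases h1 : j = i + 1
      · subst h1; simp [crossMap, pow_succ, mul_assoc]
      · simp [crossMap, h0, h1]

theorem crossMap_false_iterate (i n : ℕ) (l : ℕ → G) :
    (crossMap false i)^[n] l = fun j => if j = i ∨ j = i + 1 then
      (l (i + 1) * (l i)⁻¹) ^ n * l j else l j := by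
  induction n with
  | zero => simp
  | succ n ih =>
    rw [Function.iterate_succ_apply', ih]
    funext j
    by_cases h0 : j = i
    · subst h0; simp [crossMap, pow_succ, mul_assoc]
    · by_cases h1 : j = i + 1
      · subst h1; simp [crossMap, pow_succ, mul_assoc]
      · simp [crossMap, h0, h1]

theorem NMoveLocal.traceEquiv {n : ℕ} (hG : ∀ g : G, g ^ n = 1) {a b : List Slice}
    (h : NMoveLocal n a b) : TraceEquiv G a b := by
  obtain ⟨b, i⟩ := h
  have h := traceEquiv_crossings (G := G) (w := []) (w' := List.replicate n (b, i)) fun l => by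
    have : ∀ (k : ℕ) (l : ℕ → G), (List.replicate k (b, i)).foldl
        (fun l x => crossMap x.1 x.2 l) l = (crossMap b i)^[k] l := by
      intro k
      induction k with
      | zero => simp
      | succ k ih => intro l; simp [List.replicate_succ, ih]
    rw [this]
    cases b
    · simp [crossMap_false_iterate, hG]
    · simp [crossMap_true_iterate, hG]
  simpa using h

end Coloring

/-! ### Colourings and homomorphisms from the core group -/

section CoreGroup

variable {G : Type} [Group G]

/-! ### Widths of levels -/

theorem Fits.bottom_le {n : ℕ} {w : List Slice} (h : Fits n w) {k : ℕ} {s : Slice}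
    (hs : w[k]? = some s) : s.left + s.piece.bottom ≤ (w.take k).foldl Slice.next n := by
  induction w generalizing n k with
  | nil => simp at hs
  | cons t w ih =>
    cases k with
    | zero =>
      obtain rfl : t = s := by simpa using hs
      exact h.1
    | succ k => exact ih h.2 (by simpa using hs)

theorem Fits.foldl_next {n : ℕ} {w : List Slice} (h : Fits n w) : w.foldl Slice.next n = 0 := by
  induction w generalizing n with
  | nil => exact h
  | cons t w ih => exact ih h.2

namespace LinkDiagram

variable (D : LinkDiagram)

theorem bottom_le_width {k : ℕ} {s : Slice} (hs : D.slices[k]? = some s) :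
    s.left + s.piece.bottom ≤ D.width k := D.fits.bottom_le hs

theorem width_succ {k : ℕ} {s : Slice} (hs : D.slices[k]? = some s) :
    D.width (k + 1) = D.width k - s.piece.bottom + s.piece.top := by
  rw [width, List.take_add_one, hs, List.foldl_append]
  rfl

theorem width_of_length_le {k : ℕ} (hk : D.slices.length ≤ k) : D.width k = 0 := by
  rw [width, List.take_of_length_le hk, D.fits.foldl_next]

/-- Colours of all positions on all levels of a stack of slices, constant above its top. -/
abbrev LevelColoring (G : Type) [Group G] (w : List Slice) (l l' : ℕ → G) : Type :=
  {c : ℕ → ℕ → G // c 0 = l ∧ (∀ k, w.length ≤ k → c k = l') ∧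
    ∀ (k : ℕ) (s : Slice), w[k]? = some s → s.Step (c k) (c (k + 1))}

end LinkDiagram

open LinkDiagram

/-- Passes from the recursive description, suited to local moves, to one indexed by levels, suited
to the points of a diagram. -/
theorem nonempty_trace_equiv_levelColoring (w : List Slice) (l l' : ℕ → G) :
    Nonempty (Trace w l l' ≃ LevelColoring G w l l') := by
  induction w generalizing l with
  | nil =>
    refine nonempty_equiv_of_subsingleton inferInstance ⟨?_⟩ ?_
    · rintro ⟨c, -, h, -⟩ ⟨c', -, h', -⟩
      exact Subtype.ext (funext fun k => (h k (Nat.zero_le k)).trans (h' k (Nat.zero_le k)).symm)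
    · rw [nonempty_trace_nil]
      constructor
      · rintro rfl
        exact ⟨⟨fun _ => l, rfl, fun _ _ => rfl, by simp⟩⟩
      · rintro ⟨c, h, h', -⟩
        rw [← h, h' 0 le_rfl]
  | cons s w ih =>
    have e := fun m => (ih m).some
    refine ⟨(Equiv.sigmaCongrRight fun m : {m : ℕ → G // s.Step l m} => e m.1).trans
      { toFun := fun t => ⟨fun k => Nat.casesOn k l t.2.1, rfl, ?_, ?_⟩
        invFun := fun c => ⟨⟨c.1 1, ?_⟩, fun k => c.1 (k + 1), rfl, ?_, ?_⟩
        left_inv := ?_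
        right_inv := ?_ }⟩
    · rintro (_ | k) hk
      · simp at hk
      · exact t.2.2.2.1 k (by simpa using hk)
    · rintro (_ | k) s' hs
      · obtain rfl : s = s' := by simpa using hs
        simp only [t.2.2.1]
        exact t.1.2
      · exact t.2.2.2.2 k s' (by simpa using hs)
    · have := c.2.2.2 0 s (by simp)
      rwa [c.2.1] at this
    · exact fun k hk => c.2.2.1 (k + 1) (by simpa using hk)
    · exact fun k s' hs => c.2.2.2 (k + 1) s' (by simpa using hs)
    · rintro ⟨⟨m, hm⟩, ⟨c, h0, h⟩⟩
      obtain rfl : c 0 = m := h0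
      rfl
    · rintro ⟨c, h0, h⟩
      refine Subtype.ext (funext fun k => ?_)
      cases k with
      | zero => exact h0.symm
      | succ k => rfl

namespace LinkDiagram

variable (D : LinkDiagram)

/-- Colourings of the points of a diagram, satisfying the relations of the core group. -/
abbrev PointColoring (G : Type) [Group G] (D : LinkDiagram) : Type :=
  {c : D.Point → G // (∀ a b, D.Joined a b → c a = c b) ∧
    ∀ x y z, D.IsCrossing x y z → c y * (c x)⁻¹ * c y * (c z)⁻¹ = 1}

/-- The colours of the arcs. -/
def PointColoring.onArcs {D : LinkDiagram} (c : PointColoring G D) : D.Arc → G :=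
  Quot.lift c.1 c.2.1

/-- Homomorphisms from the core group are colourings. -/
def homEquivPointColoring : (D.CoreGroup →* G) ≃ PointColoring G D where
  toFun f := ⟨fun a => f (PresentedGroup.of (D.arc a)),
    fun a b h => congrArg (fun x => f (PresentedGroup.of x)) (Quot.sound h),
    fun x y z h => by
      rw [← map_inv, ← map_inv, ← map_mul, ← map_mul, ← map_mul]
      have := PresentedGroup.one_of_mem (rels := D.coreRelators) ⟨x, y, z, h, rfl⟩
      rw [← map_one f, ← this]
      rfl⟩
  invFun c := PresentedGroup.toGroup (f := PointColoring.onArcs c) (by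
    rintro _ ⟨x, y, z, h, rfl⟩
    rw [map_mul, map_mul, map_mul, map_inv, map_inv, FreeGroup.lift_apply_of,
      FreeGroup.lift_apply_of, FreeGroup.lift_apply_of]
    exact c.2.2 x y z h)
  left_inv f := by
    ext ⟨a⟩
    exact PresentedGroup.toGroup.of _
  right_inv c := Subtype.ext (funext fun a => PresentedGroup.toGroup.of _)

/-- Positions beyond the last strand start with colour `1` and are only shifted by each slice, so
they add no freedom to the count. -/
theorem LevelColoring.eq_one_of_width_le {D : LinkDiagram} (c : LevelColoring G D.slices 1 1)
    (k j : ℕ) (hj : D.width k ≤ j) : c.1 k j = 1 := by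
  induction k generalizing j with
  | zero => rw [c.2.1]; rfl
  | succ k ih =>
    rcases lt_or_ge k D.slices.length with hk | hk
    · have hs := List.getElem?_eq_getElem hk
      set s := D.slices[k]
      have h1 := D.bottom_le_width hs
      have h2 := D.width_succ hs
      have h3 := (c.2.2.2 k s hs).right (j - (s.left + s.piece.top))
      rw [show s.left + s.piece.top + (j - (s.left + s.piece.top)) = j by omega,
        ih _ (by omega)] at h3
      exact h3
    · rw [c.2.2.1 _ (by omega)]; rfl

open Classical in
/-- Extension of a colouring of the points by `1`. -/
noncomputable def extendOne (c : D.Point → G) (k j : ℕ) : G :=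
  if h : k ≤ D.slices.length ∧ j < D.width k then c ⟨(k, j), h⟩ else 1

theorem extendOne_of_mem (c : D.Point → G) {k j : ℕ}
    (h : k ≤ D.slices.length ∧ j < D.width k) : D.extendOne c k j = c ⟨(k, j), h⟩ := dif_pos h

theorem extendOne_of_width_le (c : D.Point → G) {k j : ℕ} (h : D.width k ≤ j) :
    D.extendOne c k j = 1 := dif_neg fun h' => absurd h'.2 (not_lt.2 h)

theorem PointColoring.step {D : LinkDiagram} (c : PointColoring G D) (k : ℕ) (s : Slice)
    (hs : D.slices[k]? = some s) : s.Step (D.extendOne c.1 k) (D.extendOne c.1 (k + 1)) := by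
  have h1 := D.bottom_le_width hs
  have h2 := D.width_succ hs
  obtain ⟨hk, hs'⟩ := List.getElem?_eq_some_iff.1 hs
  have hk0 : k ≤ D.slices.length := hk.le
  have hk1 : k + 1 ≤ D.slices.length := hk
  refine ⟨fun j hj => ?_, fun j => ?_, ?_⟩
  · rw [D.extendOne_of_mem c.1 (k := k) (j := j) ⟨hk0, by omega⟩,
      D.extendOne_of_mem c.1 (k := k + 1) (j := j) ⟨hk1, by omega⟩]
    exact (c.2.1 _ _ (.left _ _ k j s hs hj rfl rfl)).symm
  · rcases lt_or_ge (s.left + s.piece.bottom + j) (D.width k) with hj | hj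
    · rw [D.extendOne_of_mem c.1 (k := k) ⟨hk0, hj⟩,
        D.extendOne_of_mem c.1 (k := k + 1) ⟨hk1, by omega⟩]
      exact (c.2.1 _ _ (.right _ _ k j s hs rfl rfl)).symm
    · rw [D.extendOne_of_width_le c.1 hj, D.extendOne_of_width_le c.1 (by omega)]
  · obtain ⟨s, i⟩ := s
    rcases s with _ | _ | (_ | _) <;> simp only [Piece.bottom, Piece.top] at h1 h2 <;>
      simp only [Piece.Rule, add_zero]
    · rw [D.extendOne_of_mem c.1 (j := i) ⟨hk1, by omega⟩,
        D.extendOne_of_mem c.1 (j := i + 1) ⟨hk1, by omega⟩]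
      exact c.2.1 _ _ (.cup _ _ k i hs rfl rfl)
    · rw [D.extendOne_of_mem c.1 (j := i) ⟨hk0, by omega⟩,
        D.extendOne_of_mem c.1 (j := i + 1) ⟨hk0, by omega⟩]
      exact c.2.1 _ _ (.cap _ _ k i hs rfl rfl)
    · rw [D.extendOne_of_mem c.1 (k := k) (j := i) ⟨hk0, by omega⟩,
        D.extendOne_of_mem c.1 (k := k) (j := i + 1) ⟨hk0, by omega⟩,
        D.extendOne_of_mem c.1 (k := k + 1) (j := i) ⟨hk1, by omega⟩,
        D.extendOne_of_mem c.1 (k := k + 1) (j := i + 1) ⟨hk1, by omega⟩]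
      exact ⟨(c.2.1 _ _ (.overLeft _ _ k i hs rfl rfl)).symm,
        (mul_inv_eq_one.1 (c.2.2 _ _ _ (.overLeft _ _ _ k i hs rfl rfl rfl))).symm⟩
    · rw [D.extendOne_of_mem c.1 (k := k) (j := i) ⟨hk0, by omega⟩,
        D.extendOne_of_mem c.1 (k := k) (j := i + 1) ⟨hk0, by omega⟩,
        D.extendOne_of_mem c.1 (k := k + 1) (j := i) ⟨hk1, by omega⟩,
        D.extendOne_of_mem c.1 (k := k + 1) (j := i + 1) ⟨hk1, by omega⟩]
      exact ⟨(c.2.1 _ _ (.overRight _ _ k i hs rfl rfl)).symm,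
        (mul_inv_eq_one.1 (c.2.2 _ _ _ (.overRight _ _ _ k i hs rfl rfl rfl))).symm⟩

/-- Restriction of a colouring of all positions to the points of the diagram. -/
def LevelColoring.restrict {D : LinkDiagram} (c : LevelColoring G D.slices 1 1) :
    PointColoring G D where
  val a := c.1 a.1.1 a.1.2
  property := by
    refine ⟨fun a b h => ?_, fun x y z h => ?_⟩
    · beta_reduce
      cases h with
      | left k j s hs hj ha hb => rw [ha, hb]; exact ((c.2.2.2 k s hs).left j hj).symm
      | right k j s hs ha hb => rw [ha, hb]; exact ((c.2.2.2 k s hs).right j).symm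
      | cup k i hs ha hb => rw [ha, hb]; exact (c.2.2.2 k _ hs).rule
      | cap k i hs ha hb => rw [ha, hb]; exact (c.2.2.2 k _ hs).rule
      | overRight k i hs ha hb => rw [ha, hb]; exact (c.2.2.2 k _ hs).rule.1.symm
      | overLeft k i hs ha hb => rw [ha, hb]; exact (c.2.2.2 k _ hs).rule.1.symm
    · beta_reduce
      cases h with
      | overRight k i hs hx hy hz =>
        rw [hx, hy, hz, mul_inv_eq_one]; exact (c.2.2.2 k _ hs).rule.2.symm
      | overLeft k i hs hx hy hz =>
        rw [hx, hy, hz, mul_inv_eq_one]; exact (c.2.2.2 k _ hs).rule.2.symm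

/-- A colouring of all positions is determined by the colours of the points. -/
noncomputable def levelColoringEquiv : LevelColoring G D.slices 1 1 ≃ PointColoring G D where
  toFun c := c.restrict
  invFun c := ⟨D.extendOne c.1,
    funext fun j => D.extendOne_of_width_le c.1 (Nat.zero_le j),
    fun k hk => funext fun j => D.extendOne_of_width_le c.1
      (by rw [D.width_of_length_le hk]; exact Nat.zero_le j),
    c.step⟩
  left_inv c := by
    refine Subtype.ext (funext fun k => funext fun j => ?_)
    simp only [extendOne]
    split_ifs with h
    · rfl
    · rcases lt_or_ge j (D.width k) with hj | hj
      · rw [c.2.2.1 k (by by_contra hk; exact h ⟨by omega, hj⟩)]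
        rfl
      · exact (c.eq_one_of_width_le k j hj).symm
  right_inv c := Subtype.ext (funext fun a => D.extendOne_of_mem c.1 a.2)

theorem nonempty_trace_equiv_hom : Nonempty (Trace D.slices (1 : ℕ → G) 1 ≃ (D.CoreGroup →* G)) :=
  ⟨(nonempty_trace_equiv_levelColoring _ _ _).some.trans
    (D.levelColoringEquiv.trans D.homEquivPointColoring.symm)⟩

end LinkDiagram

/-! ### The number of colourings of a link -/

/-- The number of colourings of a link by a group. -/
noncomputable def Link.colorings (G : Type) [Group G] (L : Link) : ℕ :=
  Quot.lift (fun D : LinkDiagram => Nat.card (Trace D.slices (1 : ℕ → G) 1))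
    (fun D D' ⟨u, a, b, v, h, hD, hD'⟩ => by
      simp only [hD, hD']
      exact Nat.card_congr (h.traceEquiv.replace u v 1 1).some) L

theorem LinkDiagram.card_hom (D : LinkDiagram) :
    Nat.card (D.CoreGroup →* G) = D.link.colorings G :=
  (Nat.card_congr (D.nonempty_trace_equiv_hom (G := G)).some).symm

theorem Link.NMove.colorings_eq {n : ℕ} (hG : ∀ g : G, g ^ n = 1) {L L' : Link}
    (h : Link.NMove n L L') : L.colorings G = L'.colorings G := by
  obtain ⟨D, D', rfl, rfl, u, a, b, v, h, hD, hD'⟩ := h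
  change Nat.card (Trace D.slices (1 : ℕ → G) 1) = Nat.card (Trace D'.slices (1 : ℕ → G) 1)
  rw [hD, hD']
  exact Nat.card_congr ((h.traceEquiv hG).replace u v 1 1).some

theorem Link.NMoveEquiv.colorings_eq {n : ℕ} (hG : ∀ g : G, g ^ n = 1) {L L' : Link}
    (h : Link.NMoveEquiv n L L') : L.colorings G = L'.colorings G := by
  induction h with
  | rel _ _ h => exact h.colorings_eq hG
  | refl _ => rfl
  | symm _ _ _ ih => exact ih.symm
  | trans _ _ _ _ _ ih ih' => exact ih.trans ih'

/-- Each circle carries one freely chosen colour, and the level returns to `l` above it. -/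
theorem nonempty_trace_trivialSlices_equiv (k : ℕ) (l : ℕ → G) :
    Nonempty (Trace (trivialSlices k) l l ≃ (Fin k → G)) := by
  induction k with
  | zero =>
    exact nonempty_equiv_of_subsingleton (subsingleton_trace_nil _ _) inferInstance
      ⟨fun _ => ⟨Fin.elim0⟩, fun _ => ⟨⟨rfl⟩⟩⟩
  | succ k ih =>
    -- The level through the middle of a circle: two strands of colour `g` placed to the left of
    -- `l`.
    let ins : G → ℕ → G := fun g j => if j < 2 then g else l (j - 2)
    have hins : ∀ g, dropTwo 0 (ins g) = l := fun g => funext fun j => by simp [dropTwo, ins]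
    have h1 : ∀ g, Slice.Step ⟨.cup, 0⟩ l (ins g) := fun g =>
      step_cup_iff.2 ⟨(hins g).symm, by simp [ins]⟩
    have h2 : ∀ g, Slice.Step ⟨.cap, 0⟩ (ins g) l := fun g =>
      step_cap_iff.2 ⟨(hins g).symm, by simp [ins]⟩
    have h3 : ∀ m, Slice.Step ⟨.cup, 0⟩ l m → m = ins (m 0) := fun m hm => by
      obtain ⟨h, h'⟩ := step_cup_iff.1 hm
      funext j
      rcases j with _ | _ | j
      · rfl
      · exact h'.symm
      · simp [ins, h, dropTwo]
    have h4 : ∀ m m', Slice.Step ⟨.cup, 0⟩ l m → Slice.Step ⟨.cap, 0⟩ m m' → m' = l :=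
      fun m m' h h' => by
        rw [h3 m h] at h'
        rw [(step_cap_iff.1 h').1, hins]
    have e : Trace (trivialSlices (k + 1)) l l ≃ G × Trace (trivialSlices k) l l := by
      refine (Equiv.ofBijective
        (fun x => (⟨⟨ins x.1, h1 x.1⟩, ⟨l, h2 x.1⟩, x.2⟩ : Trace (trivialSlices (k + 1)) l l))
        ⟨?_, ?_⟩).symm
      · rintro ⟨g, t⟩ ⟨g', t'⟩ h
        obtain rfl : g = g' :=
          congrArg (fun t : Trace (trivialSlices (k + 1)) l l => t.1.1 0) h
        have h' := eq_of_heq (Sigma.mk.inj h).2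
        exact Prod.ext rfl (eq_of_heq (Sigma.mk.inj h').2)
      · rintro ⟨⟨m, hm⟩, ⟨m', hm'⟩, t⟩
        obtain rfl := h4 _ _ hm hm'
        obtain ⟨g, rfl⟩ : ∃ g, m = ins g := ⟨_, h3 m hm⟩
        exact ⟨(g, t), rfl⟩
    exact ⟨e.trans ((Equiv.prodCongr (Equiv.refl G) ih.some).trans (Fin.consEquiv fun _ => G))⟩

theorem Link.colorings_trivial (k : ℕ) : (Link.trivial k).colorings G = Nat.card G ^ k := by
  change Nat.card (Trace (trivialSlices k) (1 : ℕ → G) 1) = _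
  rw [Nat.card_congr (nonempty_trace_trivialSlices_equiv k (1 : ℕ → G)).some, Nat.card_fun,
    Nat.card_fin]

end CoreGroup

/-! ### Series of high order -/

namespace NCPowerSeries

section Order

variable {σ R : Type} [CommRing R]

/-- Series all of whose terms have degree at least `n`. -/
def ofOrder (σ R : Type) [CommRing R] (n : ℕ) : AddSubgroup (NCPowerSeries σ R) where
  carrier := {f | ∀ w : List σ, w.length < n → coeff w f = 0}
  zero_mem' := fun _ _ => rfl
  add_mem' := fun hf hg w hw => by rw [coeff_add, hf w hw, hg w hw, add_zero]
  neg_mem' := fun hf w hw => by rw [coeff_neg, hf w hw, neg_zero]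

theorem ofOrder_anti {m n : ℕ} (h : m ≤ n) : ofOrder σ R n ≤ ofOrder σ R m :=
  fun _ hf w hw => hf w (hw.trans_le h)

/-- If a word has length less than `m + n`, each factorization has a left factor shorter than `m` or
a right factor shorter than `n`. -/
theorem mul_mem_ofOrder {m n : ℕ} {f g : NCPowerSeries σ R} (hf : f ∈ ofOrder σ R m)
    (hg : g ∈ ofOrder σ R n) : f * g ∈ ofOrder σ R (m + n) := by
  intro w hw
  rw [coeff_mul]
  refine Finset.sum_eq_zero fun k hk => ?_
  have hk' := Finset.mem_range.1 hk
  rcases lt_or_ge k m with h | h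
  · rw [hf _ (by rw [List.length_take]; omega), zero_mul]
  · rw [hg _ (by rw [List.length_drop]; omega), mul_zero]

theorem mem_ofOrder_zero (f : NCPowerSeries σ R) : f ∈ ofOrder σ R 0 :=
  fun _ hw => absurd hw (Nat.not_lt_zero _)

theorem mem_ofOrder_one {f : NCPowerSeries σ R} : f ∈ ofOrder σ R 1 ↔ coeff [] f = 0 :=
  ⟨fun h => h [] Nat.one_pos, fun h w hw => by
    rw [List.length_eq_zero_iff.1 (Nat.lt_one_iff.1 hw), h]⟩

theorem sub_one_mem_ofOrder_one {f : NCPowerSeries σ R} (h : coeff [] f = 1) :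
    f - 1 ∈ ofOrder σ R 1 := by
  rw [mem_ofOrder_one, sub_eq_add_neg, coeff_add, coeff_neg, h, coeff_one_nil, add_neg_cancel]

/-- Series `f` of order at least `n` whose terms of degree `n` are symmetric. -/
def symmetricOrder (σ R : Type) [CommRing R] (n : ℕ) : AddSubgroup (NCPowerSeries σ R) where
  carrier := {f | f ∈ ofOrder σ R n ∧ ∀ (i : Fin n → σ) (τ : Equiv.Perm (Fin n)),
    coeff (List.ofFn (i ∘ τ)) f = coeff (List.ofFn i) f}
  zero_mem' := ⟨zero_mem _, fun _ _ => rfl⟩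
  add_mem' := fun hf hg => ⟨add_mem hf.1 hg.1, fun i τ => by
    rw [coeff_add, coeff_add, hf.2, hg.2]⟩
  neg_mem' := fun hf => ⟨neg_mem hf.1, fun i τ => by rw [coeff_neg, coeff_neg, hf.2]⟩

theorem ofOrder_succ_le_symmetricOrder (n : ℕ) :
    ofOrder σ R (n + 1) ≤ symmetricOrder σ R n :=
  fun f hf => ⟨ofOrder_anti n.le_succ hf, fun i τ => by
    rw [hf _ (by simp), hf _ (by simp)]⟩

/-- `uf - f = (u - 1)f` has order at least `n + 1`, so `u` does not affect the terms of degree `n`.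
-/
theorem mul_mem_symmetricOrder_left {n : ℕ} {u f : NCPowerSeries σ R} (hu : coeff [] u = 1)
    (hf : f ∈ symmetricOrder σ R n) : u * f ∈ symmetricOrder σ R n := by
  have h := mul_mem_ofOrder (sub_one_mem_ofOrder_one hu) hf.1
  rw [add_comm 1 n] at h
  have := add_mem (ofOrder_succ_le_symmetricOrder n h) hf
  rwa [sub_mul, one_mul, sub_add_cancel] at this

theorem mul_mem_symmetricOrder_right {n : ℕ} {u f : NCPowerSeries σ R} (hu : coeff [] u = 1)
    (hf : f ∈ symmetricOrder σ R n) : f * u ∈ symmetricOrder σ R n := by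
  have h := mul_mem_ofOrder hf.1 (sub_one_mem_ofOrder_one hu)
  have := add_mem (ofOrder_succ_le_symmetricOrder n h) hf
  rwa [mul_sub, mul_one, sub_add_cancel] at this

theorem pow_mem_ofOrder {f : NCPowerSeries σ R} (hf : coeff [] f = 0) (n : ℕ) :
    f ^ n ∈ ofOrder σ R n := by
  induction n with
  | zero => exact mem_ofOrder_zero _
  | succ n ih => rw [pow_succ]; exact mul_mem_ofOrder ih (mem_ofOrder_one.2 hf)

/-- Since `f` has order at least 1 and `g` at least `n`, only the factorization into one letter and
`n` letters contributes. -/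
theorem coeff_cons_mul_of_order {n : ℕ} {f g : NCPowerSeries σ R} (hf : coeff [] f = 0)
    (hg : g ∈ ofOrder σ R n) (a : σ) (w : List σ) (hw : w.length = n) :
    coeff (a :: w) (f * g) = coeff [a] f * coeff w g := by
  rw [coeff_mul_cons, hf, zero_mul, zero_add]
  cases w with
  | nil => simp
  | cons b w =>
    rw [coeff_mul_cons, coeff_shift]
    have h := mul_mem_ofOrder (mem_ofOrder_zero (shift b (shift a f))) hg w
      (by rw [← hw]; simp)
    rw [h, add_zero]

theorem coeff_pow_of_length {f : NCPowerSeries σ R} (hf : coeff [] f = 0) (w : List σ) :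
    coeff w (f ^ w.length) = (w.map fun a => coeff [a] f).prod := by
  induction w with
  | nil => simp
  | cons a w ih =>
    rw [List.length_cons, pow_succ', coeff_cons_mul_of_order hf (pow_mem_ofOrder hf _) a w rfl, ih,
      List.map_cons, List.prod_cons]

theorem pow_mem_symmetricOrder {f : NCPowerSeries σ R} (hf : coeff [] f = 0) (n : ℕ) :
    f ^ n ∈ symmetricOrder σ R n := by
  refine ⟨pow_mem_ofOrder hf n, fun i τ => ?_⟩
  have h : ∀ i : Fin n → σ, coeff (List.ofFn i) (f ^ n) = ∏ k, coeff [i k] f := fun i => by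
    have := coeff_pow_of_length hf (List.ofFn i)
    rw [List.length_ofFn] at this
    rw [this, List.map_ofFn, List.prod_ofFn]
    rfl
  rw [h, h]
  exact Equiv.prod_comp τ fun k => coeff [i k] f

/-- The variables do not commute, but `1` commutes with `f`, so the binomial theorem applies and the
mixed terms are multiples of `p`. -/
theorem one_add_pow_prime {p : ℕ} (hp : p.Prime) (f : NCPowerSeries σ (ZMod p)) :
    (1 + f) ^ p = 1 + f ^ p := by
  obtain ⟨r, hr⟩ := (Commute.one_left f).exists_add_pow_prime_eq hp
  have h : ∀ g : NCPowerSeries σ (ZMod p), (p : NCPowerSeries σ (ZMod p)) * g = 0 := fun g => by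
    have h0 : (p : ZMod p) • g = 0 := by rw [CharP.cast_eq_zero, zero_smul]
    rwa [Nat.cast_smul_eq_nsmul, nsmul_eq_mul] at h0
  rw [hr, one_pow]
  simp [h]

/-! ### The group of series with constant term one -/

/-- The constant term. -/
def constantCoeff (σ R : Type) [CommRing R] : NCPowerSeries σ R →+* R where
  toFun := coeff []
  map_one' := rfl
  map_mul' := coeff_mul_nil
  map_zero' := rfl
  map_add' := coeff_add []

/-- The units with constant term `1`. -/
def oneUnits (σ R : Type) [CommRing R] : Subgroup (NCPowerSeries σ R)ˣ :=
  (Units.map (constantCoeff σ R : NCPowerSeries σ R →* R)).ker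

theorem mem_oneUnits {u : (NCPowerSeries σ R)ˣ} :
    u ∈ oneUnits σ R ↔ coeff [] (u : NCPowerSeries σ R) = 1 := by
  rw [oneUnits, MonoidHom.mem_ker, Units.ext_iff]
  rfl

/-- The units `1 + f` where `f` has order at least `n` and is symmetric in degree `n`. -/
def symmetricUnits (σ R : Type) [CommRing R] (n : ℕ) : Subgroup (oneUnits σ R) where
  carrier := {u | ((u : (NCPowerSeries σ R)ˣ) : NCPowerSeries σ R) - 1 ∈ symmetricOrder σ R n}
  one_mem' := by simp
  mul_mem' := fun {u v} hu hv => by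
    -- Uses `uv - 1 = u(v - 1) + (u - 1)`; the inverse below uses `u⁻¹ - 1 = -u⁻¹(u - 1)`.
    have := add_mem (mul_mem_symmetricOrder_left (mem_oneUnits.1 u.2) hv) hu
    rw [mul_sub, mul_one, sub_add_sub_cancel] at this
    exact this
  inv_mem' := fun {u} hu => by
    have := neg_mem (mul_mem_symmetricOrder_left (mem_oneUnits.1 (u⁻¹).2) hu)
    rw [mul_sub, mul_one, neg_sub] at this
    simpa using this

theorem mem_symmetricUnits {n : ℕ} {u : oneUnits σ R} : u ∈ symmetricUnits σ R n ↔
    ((u : (NCPowerSeries σ R)ˣ) : NCPowerSeries σ R) - 1 ∈ symmetricOrder σ R n := Iff.rfl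

instance symmetricUnits_normal (n : ℕ) : (symmetricUnits σ R n).Normal where
  conj_mem u hu g := by
    have := mul_mem_symmetricOrder_right (mem_oneUnits.1 (g⁻¹).2)
      (mul_mem_symmetricOrder_left (mem_oneUnits.1 g.2) hu)
    rw [mem_symmetricUnits]
    simpa [mul_sub, sub_mul] using this

theorem quotient_symmetricUnits_pow_prime {p : ℕ} (hp : p.Prime)
    (g : oneUnits σ (ZMod p) ⧸ symmetricUnits σ (ZMod p) p) : g ^ p = 1 := by
  induction g using QuotientGroup.induction_on with
  | H u =>
    rw [← QuotientGroup.mk_pow, QuotientGroup.eq_one_iff, mem_symmetricUnits]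
    have h := mem_ofOrder_one.1 (sub_one_mem_ofOrder_one (mem_oneUnits.1 u.2))
    have := pow_mem_symmetricOrder h p
    rw [← add_sub_cancel_left 1 (_ ^ p), ← one_add_pow_prime hp, add_sub_cancel] at this
    simpa using this

/-- If `u` and `v` agree up to degree `n`, then `u⁻¹v - 1 = u⁻¹(v - u)` has order at least `n + 1`.
A class is thus determined by finitely many coefficients of a representative. -/
instance finite_quotient_symmetricUnits [Finite σ] [Finite R] (n : ℕ) :
    Finite (oneUnits σ R ⧸ symmetricUnits σ R n) := by
  have : Finite {w : List σ // w.length < n + 1} := (List.finite_length_lt σ (n + 1)).to_subtype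
  refine Finite.of_injective (β := {w : List σ // w.length < n + 1} → R)
    (fun q w => coeff w.1 ((q.out : (NCPowerSeries σ R)ˣ) : NCPowerSeries σ R)) fun q q' h => ?_
  rw [← QuotientGroup.out_eq' q, ← QuotientGroup.out_eq' q', QuotientGroup.eq,
    mem_symmetricUnits]
  have hd : ((q'.out : (NCPowerSeries σ R)ˣ) : NCPowerSeries σ R) -
      ((q.out : (NCPowerSeries σ R)ˣ) : NCPowerSeries σ R) ∈ ofOrder σ R (n + 1) := fun w hw => by
    have := congrFun h ⟨w, hw⟩
    simp only at this
    rw [sub_eq_add_neg, coeff_add, coeff_neg, this, add_neg_cancel]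
  have := mul_mem_symmetricOrder_left (mem_oneUnits.1 (q.out⁻¹).2)
    (ofOrder_succ_le_symmetricOrder n hd)
  simpa [mul_sub] using this

end Order

/-! ### Monomials and expansion in degree `n` -/

section Monomial

variable {σ R : Type} [CommRing R] [DecidableEq σ]

theorem oneAddX_mem_oneUnits (i : σ) : (oneAddX i : (NCPowerSeries σ R)ˣ) ∈ oneUnits σ R := by
  rw [mem_oneUnits]
  simp [oneAddX, coeff_X]

theorem coeff_prod_X (v w : List σ) :
    coeff w ((v.map X).prod : NCPowerSeries σ R) = if w = v then 1 else 0 := by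
  induction v generalizing w with
  | nil => cases w <;> simp
  | cons a v ih =>
    cases w with
    | nil => simp [coeff_X]
    | cons b w =>
      rw [List.map_cons, List.prod_cons, coeff_mul_cons, shift_X]
      by_cases h : b = a <;> simp [coeff_X, h, ih]

/-- Expansion of a series of the form `1 + f`, with `f` symmetric of order `n`. -/
theorem exists_expansion_of_mem_symmetricOrder [Fintype σ] {n : ℕ} {f : NCPowerSeries σ R}
    (hf : f - 1 ∈ symmetricOrder σ R n) :
    ∃ (c : (Fin n → σ) → R) (d : NCPowerSeries σ R),
      (∀ (i : Fin n → σ) (τ : Equiv.Perm (Fin n)), c (i ∘ τ) = c i) ∧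
      (∀ w : List σ, w.length < n + 1 → d.coeff w = 0) ∧
      f = 1 + ∑ i : Fin n → σ, c i • (List.ofFn fun k => X (i k)).prod + d := by
  refine ⟨fun i => coeff (List.ofFn i) (f - 1), f - 1 - ∑ i : Fin n → σ,
    coeff (List.ofFn i) (f - 1) • (List.ofFn fun k => X (i k)).prod, hf.2, fun w hw => ?_, by abel⟩
  have hsum : ∀ g : (Fin n → σ) → NCPowerSeries σ R, coeff w (∑ i, g i) = ∑ i, coeff w (g i) :=
    fun g => Finset.sum_apply w _ g
  have hX : ∀ i : Fin n → σ, coeff w ((List.ofFn fun k => X (i k)).prod : NCPowerSeries σ R) =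
      if w = List.ofFn i then 1 else 0 := fun i => by
    rw [← coeff_prod_X, List.map_ofFn]
    rfl
  rw [sub_eq_add_neg (f - 1), coeff_add, coeff_neg, hsum]
  simp only [coeff_smul, hX]
  rcases (Nat.lt_succ_iff.1 hw).lt_or_eq with h | rfl
  · rw [hf.1 w h, Finset.sum_eq_zero, neg_zero, add_zero]
    intro i _
    rw [if_neg, mul_zero]
    rintro rfl
    simp at h
  · rw [Finset.sum_eq_single w.get, List.ofFn_get, if_pos rfl, mul_one, add_neg_cancel]
    · intro i _ hi
      rw [if_neg, mul_zero]
      intro h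
      apply hi
      rw [← List.ofFn_inj, List.ofFn_get]
      exact h.symm
    · exact fun h => absurd (Finset.mem_univ _) h

end Monomial

end NCPowerSeries

/-! ### Links with free Burnside quotients -/

/-- Homomorphisms out of a presented group are the assignments that kill the relators. -/
def presentedGroupHomEquiv {α : Type} (R : Set (FreeGroup α)) (G : Type) [Group G] :
    (PresentedGroup R →* G) ≃ {f : α → G // ∀ r ∈ R, FreeGroup.lift f r = 1} where
  toFun φ := ⟨fun a => φ (PresentedGroup.of a), fun r hr => by
    have h : FreeGroup.lift (fun a => φ (PresentedGroup.of a)) = φ.comp (PresentedGroup.mk R) := by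
      ext a
      simp [PresentedGroup.of]
    rw [h, MonoidHom.comp_apply, PresentedGroup.one_of_mem hr, map_one]⟩
  invFun f := PresentedGroup.toGroup f.2
  left_inv φ := by
    ext a
    simp
  right_inv f := Subtype.ext (funext fun a => by simp)

/-- The `p^m` linear functionals on `(ℤ/p)^m` stay distinct after composition with a surjection;
preimages of the standard basis vectors separate them. -/
theorem le_card_hom_of_surjective {p m : ℕ} [NeZero p] {H : Type} [Group H]
    [Finite (H →* Multiplicative (ZMod p))]
    (φ : H →* Multiplicative (Fin m → ZMod p)) (hφ : Function.Surjective φ) :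
    p ^ m ≤ Nat.card (H →* Multiplicative (ZMod p)) := by
  let ψ : (Fin m → ZMod p) → H →* Multiplicative (ZMod p) := fun a =>
    (AddMonoidHom.toMultiplicative
      (∑ i, (AddMonoidHom.mulLeft (a i)).comp (Pi.evalAddMonoidHom (fun _ => ZMod p) i))).comp φ
  have hψ : Function.Injective ψ := fun a b hab => by
    funext i
    obtain ⟨h, hh⟩ := hφ (Multiplicative.ofAdd (Pi.single i 1))
    have := congrArg Multiplicative.toAdd (DFunLike.congr_fun hab h)
    simpa [ψ, hh, Pi.single_apply] using this
  have := Nat.card_le_card_of_injective ψ hψ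
  rwa [Nat.card_fun, Nat.card_fin, Nat.card_zmod] at this

/-- The projection of the core group onto `B / γ₂ B`, `B` the unreduced Burnside group. -/
theorem LinkDiagram.exists_surjective_gammaQuotient (D : LinkDiagram) (n q : ℕ) :
    ∃ φ : D.CoreGroup →* GammaQuotient (D.UnreducedBurnside n) q, Function.Surjective φ := by
  let φ : D.CoreGroup →* D.UnreducedBurnside n :=
    PresentedGroup.toGroup (f := PresentedGroup.of) fun r hr => by
      have h : FreeGroup.lift (PresentedGroup.of (rels := D.coreRelators ∪ powerWords D.Arc n)) =
          PresentedGroup.mk _ := by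
        ext a
        simp [PresentedGroup.of]
      rw [h]
      exact PresentedGroup.one_of_mem (Or.inl hr)
  have hφ : Function.Surjective φ := by
    rw [← MonoidHom.range_eq_top, eq_top_iff, ← PresentedGroup.closure_range_of,
      Subgroup.closure_le]
    rintro _ ⟨a, rfl⟩
    exact ⟨PresentedGroup.of a, by simp [φ]⟩
  exact ⟨(QuotientGroup.mk' _).comp φ, (QuotientGroup.mk'_surjective _).comp hφ⟩

/-- Under the assumptions of the main theorem, the relators are laws of all finite groups of
exponent `p`. -/
theorem lift_eq_one_of_nMoveEquiv_trivial {p : ℕ} (hp : p.Prime) {m k : ℕ}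
    {R : Set (FreeGroup (Fin m))} {D : LinkDiagram}
    (e : D.CoreGroup ≃* PresentedGroup R)
    (e' : GammaQuotient (D.UnreducedBurnside p) 2 ≃* Multiplicative (Fin m → ZMod p))
    (h : Link.NMoveEquiv p D.link (Link.trivial k))
    {G : Type} [Group G] [Finite G] (hG : ∀ g : G, g ^ p = 1) (f : Fin m → G)
    {r : FreeGroup (Fin m)} (hr : r ∈ R) : FreeGroup.lift f r = 1 := by
  have : NeZero p := ⟨hp.ne_zero⟩
  have key : ∀ (K : Type) [Group K], (∀ g : K, g ^ p = 1) →
      Nat.card (D.CoreGroup →* K) = Nat.card K ^ k := fun K _ hK => by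
    rw [D.card_hom, h.colorings_eq hK, Link.colorings_trivial]
  have homEquiv : ∀ (K : Type) [Group K],
      (D.CoreGroup →* K) ≃ {f : Fin m → K // ∀ r ∈ R, FreeGroup.lift f r = 1} := fun K _ =>
    (e.monoidHomCongrLeftEquiv).trans (presentedGroupHomEquiv R K)
  -- The Burnside quotient enters only here, through homomorphisms to `ℤ/p`.
  have hmk : m ≤ k := by
    obtain ⟨φ, hφ⟩ := D.exists_surjective_gammaQuotient p 2
    have : Finite (D.CoreGroup →* Multiplicative (ZMod p)) := Finite.of_equiv _ (homEquiv _).symm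
    have hle := le_card_hom_of_surjective (e'.toMonoidHom.comp φ) (e'.surjective.comp hφ)
    rw [key (Multiplicative (ZMod p)) fun g => by
      rw [← ofAdd_toAdd g, ← ofAdd_nsmul]; simp] at hle
    rw [show Nat.card (Multiplicative (ZMod p)) = p from Nat.card_zmod p] at hle
    exact (Nat.pow_le_pow_iff_right hp.one_lt).1 hle
  have hcard : Nat.card (Fin m → G) ≤
      Nat.card {f : Fin m → G // ∀ r ∈ R, FreeGroup.lift f r = 1} := by
    rw [← Nat.card_congr (homEquiv G), key G hG, Nat.card_fun, Nat.card_fin]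
    exact Nat.pow_le_pow_right Nat.card_pos hmk
  -- The maps killing `R` are at least as numerous as all maps to the finite group `G`, so the
  -- inclusion is onto.
  have hbij := (Nat.bijective_iff_injective_and_card
    (Subtype.val : {f : Fin m → G // ∀ r ∈ R, FreeGroup.lift f r = 1} → Fin m → G)).2
    ⟨Subtype.val_injective, le_antisymm
      (Nat.card_le_card_of_injective _ Subtype.val_injective) hcard⟩
  obtain ⟨f', rfl⟩ := hbij.2 f
  exact f'.2 r hr

/-! ### The Magnus expansion of a relator -/

theorem theorem3 (p : ℕ) (hp : p.Prime) (m : ℕ) (R : Set (FreeGroup (Fin m)))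
    (L : Link) (D : LinkDiagram) (hD : D.link = L)
    (hcore : Nonempty (D.CoreGroup ≃* PresentedGroup R))
    (hburnside : Nonempty (GammaQuotient (D.UnreducedBurnside p) 2 ≃*
      Multiplicative (Fin m → ZMod p)))
    (htriv : ∃ k : ℕ, Link.NMoveEquiv p L (Link.trivial k))
    (r : FreeGroup (Fin m)) (hr : r ∈ R) :
    ∃ (c : (Fin p → Fin m) → ZMod p) (d : NCPowerSeries (Fin m) (ZMod p)),
      (∀ (i : Fin p → Fin m) (σ : Equiv.Perm (Fin p)), c (i ∘ σ) = c i) ∧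
      (∀ w : List (Fin m), w.length < p + 1 → d.coeff w = 0) ∧
      magnus p m r =
        1 + ∑ i : Fin p → Fin m, c i • (List.ofFn fun k => NCPowerSeries.X (i k)).prod + d := by
  subst hD
  obtain ⟨k, hk⟩ := htriv
  have : NeZero p := ⟨hp.ne_zero⟩
  apply NCPowerSeries.exists_expansion_of_mem_symmetricOrder
  let x : Fin m → NCPowerSeries.oneUnits (Fin m) (ZMod p) := fun i =>
    ⟨NCPowerSeries.oneAddX i, NCPowerSeries.oneAddX_mem_oneUnits i⟩
  -- The law is evaluated at the classes of `1 + X_i`; it says that the class of the Magnus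
  -- expansion of `r` is trivial.
  have h := lift_eq_one_of_nMoveEquiv_trivial hp hcore.some hburnside.some hk
    (NCPowerSeries.quotient_symmetricUnits_pow_prime hp)
    (fun i => QuotientGroup.mk' (NCPowerSeries.symmetricUnits (Fin m) (ZMod p) p) (x i)) hr
  have hlift : FreeGroup.lift (fun i =>
      QuotientGroup.mk' (NCPowerSeries.symmetricUnits (Fin m) (ZMod p) p) (x i)) =
      (QuotientGroup.mk' _).comp (FreeGroup.lift x) := by
    ext i
    simp
  rw [hlift, MonoidHom.comp_apply, QuotientGroup.mk'_apply, QuotientGroup.eq_one_iff,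
    NCPowerSeries.mem_symmetricUnits] at h
  have hx : (Subgroup.subtype _).comp (FreeGroup.lift x) =
      FreeGroup.lift (NCPowerSeries.oneAddX (R := ZMod p)) := by
    ext i : 1
    simp [x]
  rw [magnus, ← hx]
  exact h
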